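/- Let $m_1,m_2,n$ be positive integers, let $X=B^{m_1+1}\times B^{m_2+1}$ be the product of two open unit balls, equipped with the product of the Poincaré metrics, and let $B^{n+1}$ also carry its Poincaré metric $4|dx|^2/(1-|x|^2)^2$. Put $\overline X=\overline{B^{m_1+1}}\times\overline{B^{m_2+1}}$, let $\partial X=(\partial B^{m_1+1}\times\overline{B^{m_2+1}})\cup(\overline{B^{m_1+1}}\times\partial B^{m_2+1})$ be its topological boundary, and let $\angle X=\partial B^{m_1+1}\times\partial B^{m_2+1}$ be its corner. Let $u\colon\overline X\to\overline{B^{n+1}}$ be a continuous map with $u(\angle X)\subset\partial B^{n+1}$ and $u(\overline X\setminus\angle X)\subset B^{n+1}$, and suppose that - $\varphi=u|_{\angle X}\colon\angle X\to\partial B^{n+1}$ is a $C^1$ map whose partial differentials $d_1\varphi$ and $d_2\varphi$ (along the first and the second factor of $\angle X$) are both nowhere vanishing; - $u\in C^2(\overline X\setminus\angle X,B^{n+1})$; - the pointwise norm $|\tau(u)|$ of the tension field $\tau(u)=\operatorname{tr}\nabla du$ of $u|_X\colon X\to B^{n+1}$, measured in the Poincaré metric of $B^{n+1}$, tends to zero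 uniformly at $\partial X$; - $u\in C^2(\overline X,\overline{B^{n+1}})$, i.e. $u$ is $C^2$ up to the whole boundary. Then $m_1=m_2=1$. -/

import Mathlib

open scoped Manifold ContDiff

namespace HypProd

/-! ### Riemannian geometry in a linear coordinate system -/

section Riemannian

variable {ι κ V W : Type*} [Fintype ι] [DecidableEq ι] [Fintype κ] [DecidableEq κ]
  [NormedAddCommGroup V] [NormedSpace ℝ V] [NormedAddCommGroup W] [NormedSpace ℝ W]

/-- The partial derivative of `f` at `x` in the `i`-th coordinate direction of the basis `b`. -/
noncomputable def pd (b : Module.Basis ι ℝ V) (i : ι) (f : V → ℝ) (x : V) : ℝ :=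
  fderiv ℝ f x (b i)

/-- The matrix `(g_{ij}(x))` of a metric `g`, where `g x v w` is the inner product at the point `x`
of the tangent vectors `v` and `w`. -/
noncomputable def gram (b : Module.Basis ι ℝ V) (g : V → V → V → ℝ) (x : V) : Matrix ι ι ℝ :=
  Matrix.of fun i j => g x (b i) (b j)

/-- The Christoffel symbol `Γ^k_{ij}` of the Levi-Civita connection of `g` at `x`. -/
noncomputable def christoffel (b : Module.Basis ι ℝ V) (g : V → V → V → ℝ) (k i j : ι) (x : V) : ℝ :=
  (1 / 2) * ∑ l, (gram b g x)⁻¹ k l *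
    (pd b i (fun y => gram b g y j l) x + pd b j (fun y => gram b g y i l) x
      - pd b l (fun y => gram b g y i j) x)

/-- The component `τ^k` of the tension field `τ(u) = tr_g ∇du` at `x` of a map `u` from a domain of
`V` with the metric `g` to a domain of `W` with the metric `h`:
`τ^k = g^{ij} (∂_i ∂_j u^k - Γ^l_{ij} ∂_l u^k + Γ^k_{ac}(u) ∂_i u^a ∂_j u^c)`. -/
noncomputable def tensionCoord (b : Module.Basis ι ℝ V) (g : V → V → V → ℝ)
    (c : Module.Basis κ ℝ W) (h : W → W → W → ℝ) (u : V → W) (x : V) (k : κ) : ℝ :=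
  ∑ i, ∑ j, (gram b g x)⁻¹ i j *
    (pd b i (pd b j fun y => c.repr (u y) k) x
      - ∑ l, christoffel b g l i j x * pd b l (fun y => c.repr (u y) k) x
      + ∑ p, ∑ q, christoffel c h k p q (u x) *
          pd b i (fun y => c.repr (u y) p) x * pd b j (fun y => c.repr (u y) q) x)

/-- The tension field, as a tangent vector at `u x`. -/
noncomputable def tension (b : Module.Basis ι ℝ V) (g : V → V → V → ℝ)
    (c : Module.Basis κ ℝ W) (h : W → W → W → ℝ) (u : V → W) (x : V) : W :=
  ∑ k, tensionCoord b g c h u x k • c k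

end Riemannian

/-! ### Products of Poincaré balls -/

/-- Euclidean space of dimension `m + 1`, which contains the unit ball `B^{m+1}`. -/
abbrev Euc (m : ℕ) : Type := EuclideanSpace ℝ (Fin (m + 1))

/-- The sphere `∂B^{m+1}`, a smooth manifold of dimension `m`. -/
abbrev Sph (m : ℕ) : Type := Metric.sphere (0 : Euc m) 1

/-- The standard coordinates on `ℝ^{m+1}`. -/
noncomputable def stdBasis (m : ℕ) : Module.Basis (Fin (m + 1)) ℝ (Euc m) :=
  (EuclideanSpace.basisFun (Fin (m + 1)) ℝ).toBasis

/-- The Poincaré metric `4 |dx|² / (1 - |x|²)²` on the unit ball `B^{m+1}`. -/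
noncomputable def poincare (m : ℕ) (x v w : Euc m) : ℝ :=
  4 / (1 - ‖x‖ ^ 2) ^ 2 * inner ℝ v w

/-- The product of the Poincaré metrics on `B^{m₁+1} × B^{m₂+1}`. -/
noncomputable def prodPoincare (m₁ m₂ : ℕ) (x v w : Euc m₁ × Euc m₂) : ℝ :=
  poincare m₁ x.1 v.1 w.1 + poincare m₂ x.2 v.2 w.2

/-- `X = B^{m₁+1} × B^{m₂+1}`. -/
def space (m₁ m₂ : ℕ) : Set (Euc m₁ × Euc m₂) :=
  Metric.ball 0 1 ×ˢ Metric.ball 0 1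

/-- The closure of `X`: the product of the closed balls. -/
def closedSpace (m₁ m₂ : ℕ) : Set (Euc m₁ × Euc m₂) :=
  Metric.closedBall 0 1 ×ˢ Metric.closedBall 0 1

/-- The topological boundary `(∂B^{m₁+1} × closed ball) ∪ (closed ball × ∂B^{m₂+1})`. -/
def topBoundary (m₁ m₂ : ℕ) : Set (Euc m₁ × Euc m₂) :=
  Metric.sphere 0 1 ×ˢ Metric.closedBall 0 1 ∪ Metric.closedBall 0 1 ×ˢ Metric.sphere 0 1

/-- The corner (distinguished boundary) `∂B^{m₁+1} × ∂B^{m₂+1}`. -/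
def corner (m₁ m₂ : ℕ) : Set (Euc m₁ × Euc m₂) :=
  Metric.sphere 0 1 ×ˢ Metric.sphere 0 1

/-- The tension field at `x ∈ X` of a map `u` from `X` to the Poincaré ball `B^{n+1}`. -/
noncomputable def hypTension {m₁ m₂ n : ℕ} (u : Euc m₁ × Euc m₂ → Euc n) (x : Euc m₁ × Euc m₂) :
    Euc n :=
  tension ((stdBasis m₁).prod (stdBasis m₂)) (prodPoincare m₁ m₂) (stdBasis n) (poincare n) u x

/-- The pointwise norm `|τ(u)|` at `x`, with respect to the Poincaré metric at `u x`. -/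
noncomputable def hypTensionNorm {m₁ m₂ n : ℕ} (u : Euc m₁ × Euc m₂ → Euc n)
    (x : Euc m₁ × Euc m₂) : ℝ :=
  Real.sqrt (poincare n (u x) (hypTension u x) (hypTension u x))

/-- The assumptions on a map `u` from the closure of `X` to the closed ball `B^{n+1}` with corner
value `φ`. Only the values of `u` on the closure of `X` matter. -/
structure LiTamHypotheses {m₁ m₂ n : ℕ} (u : Euc m₁ × Euc m₂ → Euc n)
    (φ : Sph m₁ × Sph m₂ → Sph n) : Prop where
  continuousOn : ContinuousOn u (closedSpace m₁ m₂)
  mapsTo_corner : Set.MapsTo u (corner m₁ m₂) (Metric.sphere 0 1)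
  mapsTo_off_corner : Set.MapsTo u (closedSpace m₁ m₂ \ corner m₁ m₂) (Metric.ball 0 1)
  /-- `φ` is the restriction of `u` to the corner. -/
  corner_value : ∀ (q₁ : Sph m₁) (q₂ : Sph m₂), u ((q₁ : Euc m₁), (q₂ : Euc m₂)) = φ (q₁, q₂)
  contMDiff_corner_value : ContMDiff ((𝓡 m₁).prod (𝓡 m₂)) (𝓡 n) 1 φ
  /-- The partial differential `d₁φ` vanishes nowhere. -/
  nondegenerate₁ : ∀ (q₁ : Sph m₁) (q₂ : Sph m₂),
    mfderiv (𝓡 m₁) (𝓡 n) (fun q : Sph m₁ => φ (q, q₂)) q₁ ≠ 0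
  /-- The partial differential `d₂φ` vanishes nowhere. -/
  nondegenerate₂ : ∀ (q₁ : Sph m₁) (q₂ : Sph m₂),
    mfderiv (𝓡 m₂) (𝓡 n) (fun q : Sph m₂ => φ (q₁, q)) q₂ ≠ 0
  /-- `u` is `C²` up to the topological boundary away from the corner. -/
  contDiffOn_off_corner : ContDiffOn ℝ 2 u (closedSpace m₁ m₂ \ corner m₁ m₂)
  /-- `|τ(u)|` tends to zero uniformly at the topological boundary. -/
  tension_tendsto_zero : ∀ ε : ℝ, 0 < ε → ∃ δ : ℝ, 0 < δ ∧ ∀ p ∈ space m₁ m₂,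
    ∀ q ∈ topBoundary m₁ m₂, dist p q < δ → hypTensionNorm u p < ε
  /-- `u` is `C¹` up to the whole boundary. -/
  contDiffOn_one : ContDiffOn ℝ 1 u (closedSpace m₁ m₂)

end HypProd

/-! Write `bdf` as ρ₁, ρ₂ on the two factors and as r at `u`. Each Poincaré metric is ρ⁻²|dx|², so
the tension field is explicit: second derivatives weighted by ρᵢ², first derivatives weighted by (mᵢ
- 1)ρᵢ, and a term quadratic in du, weighted by ρᵢ², with a pole 1/r. Pairing with u and multiplying
by r removes the pole (`inner_tension`).

Approach a corner point q along ((1 - αε)q₁, (1 - βε)q₂). Then ρ₁ ~ αε, ρ₂ ~ βε and r ~ (αA + βB)ε,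
where A, B are the radial components of the two radial derivatives of u at q. At order ε² the second
derivatives drop out, since they are bounded and carry a factor of order ε³; the tension contributes
nothing because |τ(u)| → 0. What remains is a quadratic form in (α, β) that vanishes for all α, β >
0 (`corner_quadratic_relation`).

Since u maps the corner to the sphere, tangential derivatives are orthogonal to u(q)
(`sum_sq_inner_fderivWithin`). With E₁, E₂ the squared norms of the partial differentials of u, the
coefficients give (m₁ + 1)A² = E₁, (m₂ + 1)B² = E₂ and AB(m₁ + m₂ - 2) = 0. Nondegeneracy of φ makes
E₁, E₂ positive (`sum_norm_sq_fderivWithin_pos`), so AB ≠ 0 and m₁ + m₂ = 2. -/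

namespace HypProd

/-! ### Christoffel symbols and tension field for diagonal metrics -/

section Riemannian

variable {ι κ V W : Type*} [Fintype ι] [DecidableEq ι] [Fintype κ] [DecidableEq κ]
  [NormedAddCommGroup V] [NormedSpace ℝ V] [NormedAddCommGroup W] [NormedSpace ℝ W]

theorem inv_diagonal_of_ne_zero {d : ι → ℝ} (hd : ∀ i, d i ≠ 0) :
    (Matrix.diagonal d)⁻¹ = Matrix.diagonal fun i => (d i)⁻¹ := by
  apply Matrix.inv_eq_right_inv
  rw [Matrix.diagonal_mul_diagonal, ← Matrix.diagonal_one]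
  congr 1
  ext i
  exact mul_inv_cancel₀ (hd i)

omit [Fintype ι] in
theorem pd_diagonal (b : Module.Basis ι ℝ V) (d : V → ι → ℝ) (i j l : ι) (x : V) :
    pd b i (fun y => Matrix.diagonal (d y) j l) x = if j = l then pd b i (fun y => d y l) x else 0 := by
  by_cases h : j = l
  · subst h; simp
  · simp [h, pd]

theorem christoffel_of_diagonal (b : Module.Basis ι ℝ V) {g : V → V → V → ℝ} {d : V → ι → ℝ}
    (hg : ∀ y, gram b g y = Matrix.diagonal (d y)) {x : V} (hx : ∀ i, d x i ≠ 0) (k i j : ι) :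
    christoffel b g k i j x = (1 / 2) * (d x k)⁻¹ *
      ((if j = k then pd b i (fun y => d y k) x else 0)
        + (if i = k then pd b j (fun y => d y k) x else 0)
        - (if i = j then pd b k (fun y => d y j) x else 0)) := by
  simp only [christoffel, hg, inv_diagonal_of_ne_zero hx, pd_diagonal]
  rw [Finset.sum_eq_single k]
  · rw [Matrix.diagonal_apply_eq, mul_assoc]
  · intro l _ hl
    rw [Matrix.diagonal_apply_ne _ hl.symm, zero_mul]
  · simp

theorem tensionCoord_of_diagonal (b : Module.Basis ι ℝ V) {g : V → V → V → ℝ} {d : V → ι → ℝ}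
    (hg : ∀ y, gram b g y = Matrix.diagonal (d y)) {x : V} (hx : ∀ i, d x i ≠ 0)
    (c : Module.Basis κ ℝ W) (h : W → W → W → ℝ) (u : V → W) (k : κ) :
    tensionCoord b g c h u x k = ∑ i, (d x i)⁻¹ *
      (pd b i (pd b i fun y => c.repr (u y) k) x
      - ∑ l, christoffel b g l i i x * pd b l (fun y => c.repr (u y) k) x
      + ∑ p, ∑ q, christoffel c h k p q (u x) *
          pd b i (fun y => c.repr (u y) p) x * pd b i (fun y => c.repr (u y) q) x) := by
  unfold tensionCoord
  refine Finset.sum_congr rfl fun i _ => ?_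
  rw [hg, inv_diagonal_of_ne_zero hx, Finset.sum_eq_single i]
  · rw [Matrix.diagonal_apply_eq]
  · intro l _ hl
    rw [Matrix.diagonal_apply_ne _ hl.symm, zero_mul]
  · simp

end Riemannian

/-! ### The Poincaré metric as a conformally flat metric -/

/-- The boundary defining function `(1 - |x|²) / 2` of the unit ball. -/
noncomputable def bdf {m : ℕ} (x : Euc m) : ℝ := (1 - ‖x‖ ^ 2) / 2

theorem bdf_pos {m : ℕ} {x : Euc m} (hx : x ∈ Metric.ball (0 : Euc m) 1) : 0 < bdf x := by
  have h : ‖x‖ < 1 := by simpa using hx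
  have := norm_nonneg x
  unfold bdf
  nlinarith

theorem hasFDerivAt_bdf {m : ℕ} (x : Euc m) : HasFDerivAt bdf (-(innerSL ℝ x)) x := by
  have h := ((hasStrictFDerivAt_norm_sq x).hasFDerivAt.const_sub (1 : ℝ)).mul_const (1 / 2 : ℝ)
  have e : (bdf : Euc m → ℝ) = fun y => (1 - ‖y‖ ^ 2) * (1 / 2) := by
    ext y; unfold bdf; ring
  rw [e]
  refine h.congr_fderiv ?_
  ext y
  simp

theorem poincare_eq {m : ℕ} (x v w : Euc m) :
    poincare m x v w = (bdf x ^ 2)⁻¹ * inner ℝ v w := by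
  unfold poincare bdf
  congr 1
  rw [div_pow, inv_div]; norm_num

@[simp] theorem stdBasis_apply {m : ℕ} (i : Fin (m + 1)) :
    stdBasis m i = EuclideanSpace.single i (1 : ℝ) := by
  simp [stdBasis]

@[simp] theorem stdBasis_repr {m : ℕ} (x : Euc m) (i : Fin (m + 1)) :
    (stdBasis m).repr x i = x i := by
  simp [stdBasis]

theorem gram_poincare (m : ℕ) (x : Euc m) :
    gram (stdBasis m) (poincare m) x = Matrix.diagonal fun _ => (bdf x ^ 2)⁻¹ := by
  ext i j
  simp [gram, poincare_eq, Matrix.diagonal_apply, EuclideanSpace.inner_single_left,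
    eq_comm]

theorem gram_prodPoincare (m₁ m₂ : ℕ) (x : Euc m₁ × Euc m₂) :
    gram ((stdBasis m₁).prod (stdBasis m₂)) (prodPoincare m₁ m₂) x =
      Matrix.diagonal (Sum.elim (fun _ => (bdf x.1 ^ 2)⁻¹) fun _ => (bdf x.2 ^ 2)⁻¹) := by
  ext i j
  rcases i with i | i <;> rcases j with j | j <;>
  simp [gram, prodPoincare, poincare_eq, Matrix.diagonal_apply, EuclideanSpace.inner_single_left,
    eq_comm]

theorem hasFDerivAt_inv_bdf_sq {m : ℕ} {x : Euc m} (hx : bdf x ≠ 0) :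
    HasFDerivAt (fun y : Euc m => (bdf y ^ 2)⁻¹) ((2 * (bdf x ^ 3)⁻¹) • innerSL ℝ x) x := by
  have h := (hasDerivAt_inv (pow_ne_zero 2 hx)).comp_hasFDerivAt x ((hasFDerivAt_bdf x).pow 2)
  refine h.congr_fderiv ?_
  ext v
  simp
  field_simp

theorem pd_inv_bdf_sq {m : ℕ} {x : Euc m} (hx : bdf x ≠ 0) (i : Fin (m + 1)) :
    pd (stdBasis m) i (fun y : Euc m => (bdf y ^ 2)⁻¹) x = 2 * (bdf x ^ 3)⁻¹ * x i := by
  rw [pd, (hasFDerivAt_inv_bdf_sq hx).fderiv]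
  simp [EuclideanSpace.inner_single_right]

/-- The metric is `bdf`⁻² times the Euclidean one and the gradient of `bdf` is -x, so the
logarithmic derivative of 1/`bdf` is x/`bdf`. -/
theorem christoffel_poincare {m : ℕ} {x : Euc m} (hx : bdf x ≠ 0) (k i j : Fin (m + 1)) :
    christoffel (stdBasis m) (poincare m) k i j x = (bdf x)⁻¹ *
      ((if j = k then x i else 0) + (if i = k then x j else 0) - (if i = j then x k else 0)) := by
  rw [christoffel_of_diagonal (stdBasis m) (gram_poincare m)
    (fun _ => inv_ne_zero (pow_ne_zero 2 hx))]
  simp only [pd_inv_bdf_sq hx]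
  split_ifs <;> field_simp <;> ring

theorem sum_christoffel_poincare {m : ℕ} {x : Euc m} (hx : bdf x ≠ 0) (v : Euc m)
    (k : Fin (m + 1)) :
    ∑ p, ∑ q, christoffel (stdBasis m) (poincare m) k p q x * v p * v q =
      (bdf x)⁻¹ * (2 * inner ℝ x v * v k - ‖v‖ ^ 2 * x k) := by
  have h : ∀ p q, christoffel (stdBasis m) (poincare m) k p q x * v p * v q =
      (bdf x)⁻¹ * ((if q = k then x p * v p * v q else 0) + (if p = k then x q * v q * v p else 0)
        - (if p = q then x k * (v p * v q) else 0)) := by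
    intro p q
    rw [christoffel_poincare hx]
    split_ifs <;> ring
  simp only [h, ← Finset.mul_sum, Finset.sum_sub_distrib, Finset.sum_add_distrib]
  congr 1
  rw [EuclideanSpace.real_norm_sq_eq]
  simp only [PiLp.inner_apply, Finset.sum_ite_eq, Finset.sum_ite_eq', Finset.mem_univ, if_true,
    RCLike.inner_apply, conj_trivial, ← Finset.mul_sum]
  have h2 : ∑ p, (∑ q, if p = k then x q * v q * v p else 0) = (∑ p, x p * v p) * v k := by
    rw [Finset.sum_eq_single k]
    · simp [Finset.sum_mul]
    · intro b _ hb; simp [hb]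
    · simp
  rw [h2, ← Finset.sum_mul]
  simp only [mul_comm (v _) (x _), sq]
  ring

theorem pd_prod_inl_fst {m₁ m₂ : ℕ} {x : Euc m₁ × Euc m₂} (hx : bdf x.1 ≠ 0) (i : Fin (m₁ + 1)) :
    pd ((stdBasis m₁).prod (stdBasis m₂)) (Sum.inl i)
      (fun y : Euc m₁ × Euc m₂ => (bdf y.1 ^ 2)⁻¹) x = 2 * (bdf x.1 ^ 3)⁻¹ * x.1 i := by
  have h := (hasFDerivAt_inv_bdf_sq hx).comp x hasFDerivAt_fst
  rw [pd, show (fun y : Euc m₁ × Euc m₂ => (bdf y.1 ^ 2)⁻¹)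
    = (fun y : Euc m₁ => (bdf y ^ 2)⁻¹) ∘ Prod.fst from rfl, h.fderiv]
  simp [EuclideanSpace.inner_single_right]

theorem pd_prod_inr_fst {m₁ m₂ : ℕ} {x : Euc m₁ × Euc m₂} (hx : bdf x.1 ≠ 0) (i : Fin (m₂ + 1)) :
    pd ((stdBasis m₁).prod (stdBasis m₂)) (Sum.inr i)
      (fun y : Euc m₁ × Euc m₂ => (bdf y.1 ^ 2)⁻¹) x = 0 := by
  have h := (hasFDerivAt_inv_bdf_sq hx).comp x hasFDerivAt_fst
  rw [pd, show (fun y : Euc m₁ × Euc m₂ => (bdf y.1 ^ 2)⁻¹)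
    = (fun y : Euc m₁ => (bdf y ^ 2)⁻¹) ∘ Prod.fst from rfl, h.fderiv]
  simp

theorem pd_prod_inr_snd {m₁ m₂ : ℕ} {x : Euc m₁ × Euc m₂} (hx : bdf x.2 ≠ 0) (i : Fin (m₂ + 1)) :
    pd ((stdBasis m₁).prod (stdBasis m₂)) (Sum.inr i)
      (fun y : Euc m₁ × Euc m₂ => (bdf y.2 ^ 2)⁻¹) x = 2 * (bdf x.2 ^ 3)⁻¹ * x.2 i := by
  have h := (hasFDerivAt_inv_bdf_sq hx).comp x hasFDerivAt_snd
  rw [pd, show (fun y : Euc m₁ × Euc m₂ => (bdf y.2 ^ 2)⁻¹)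
    = (fun y : Euc m₂ => (bdf y ^ 2)⁻¹) ∘ Prod.snd from rfl, h.fderiv]
  simp [EuclideanSpace.inner_single_right]

theorem pd_prod_inl_snd {m₁ m₂ : ℕ} {x : Euc m₁ × Euc m₂} (hx : bdf x.2 ≠ 0) (i : Fin (m₁ + 1)) :
    pd ((stdBasis m₁).prod (stdBasis m₂)) (Sum.inl i)
      (fun y : Euc m₁ × Euc m₂ => (bdf y.2 ^ 2)⁻¹) x = 0 := by
  have h := (hasFDerivAt_inv_bdf_sq hx).comp x hasFDerivAt_snd
  rw [pd, show (fun y : Euc m₁ × Euc m₂ => (bdf y.2 ^ 2)⁻¹)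
    = (fun y : Euc m₂ => (bdf y ^ 2)⁻¹) ∘ Prod.snd from rfl, h.fderiv]
  simp

/-! ### The tension field on the product of balls -/

/-- The trace over m₁ + 1 directions gives 2 - (m₁ + 1) = 1 - m₁. This is the only place where the
dimension of the first factor enters the tension field explicitly; `f` stands for the partial
derivatives of a component of u. -/
theorem sum_inl_christoffel_prodPoincare {m₁ m₂ : ℕ} {x : Euc m₁ × Euc m₂} (h₁ : bdf x.1 ≠ 0)
    (h₂ : bdf x.2 ≠ 0) (f : Fin (m₁ + 1) ⊕ Fin (m₂ + 1) → ℝ) :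
    ∑ i, bdf x.1 ^ 2 * ∑ l, christoffel ((stdBasis m₁).prod (stdBasis m₂)) (prodPoincare m₁ m₂)
      l (Sum.inl i) (Sum.inl i) x * f l =
      (1 - m₁) * bdf x.1 * ∑ i, x.1 i * f (Sum.inl i) := by
  have hd : ∀ i : Fin (m₁ + 1) ⊕ Fin (m₂ + 1),
      Sum.elim (fun _ => (bdf x.1 ^ 2)⁻¹) (fun _ => (bdf x.2 ^ 2)⁻¹) i ≠ 0 := by
    rintro (i | i)
    exacts [inv_ne_zero (pow_ne_zero 2 h₁), inv_ne_zero (pow_ne_zero 2 h₂)]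
  have key : ∀ i, bdf x.1 ^ 2 * ∑ l, christoffel ((stdBasis m₁).prod (stdBasis m₂))
      (prodPoincare m₁ m₂) l (Sum.inl i) (Sum.inl i) x * f l =
      bdf x.1 * (2 * (x.1 i * f (Sum.inl i)) - ∑ l, x.1 l * f (Sum.inl l)) := by
    intro i
    simp only [christoffel_of_diagonal _ (gram_prodPoincare m₁ m₂) hd, Fintype.sum_sum_type,
      Sum.elim_inl, Sum.elim_inr, pd_prod_inl_fst h₁, pd_prod_inr_fst h₁, Sum.inl.injEq,
      reduceCtorEq, if_false, if_true, add_zero, sub_zero, mul_zero, zero_mul,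
      Finset.sum_const_zero]
    have : ∀ l, 1 / 2 * (bdf x.1 ^ 2)⁻¹⁻¹ * ((if i = l then 2 * (bdf x.1 ^ 3)⁻¹ * x.1 i else 0)
        + (if i = l then 2 * (bdf x.1 ^ 3)⁻¹ * x.1 i else 0) - 2 * (bdf x.1 ^ 3)⁻¹ * x.1 l)
          * f (Sum.inl l)
        = (bdf x.1)⁻¹ * ((if i = l then 2 * (x.1 l * f (Sum.inl l)) else 0)
          - x.1 l * f (Sum.inl l)) := by
      intro l
      split_ifs with h
      · subst h; field_simp; ring
      · field_simp; ring
    simp only [this, ← Finset.mul_sum, Finset.sum_sub_distrib, Finset.sum_ite_eq,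
      Finset.mem_univ, if_true]
    field_simp
  simp only [key, ← Finset.mul_sum, Finset.sum_sub_distrib, Finset.sum_const, Finset.card_univ,
    Fintype.card_fin, nsmul_eq_mul]
  push_cast
  ring

theorem sum_inr_christoffel_prodPoincare {m₁ m₂ : ℕ} {x : Euc m₁ × Euc m₂} (h₁ : bdf x.1 ≠ 0)
    (h₂ : bdf x.2 ≠ 0) (f : Fin (m₁ + 1) ⊕ Fin (m₂ + 1) → ℝ) :
    ∑ i, bdf x.2 ^ 2 * ∑ l, christoffel ((stdBasis m₁).prod (stdBasis m₂)) (prodPoincare m₁ m₂)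
      l (Sum.inr i) (Sum.inr i) x * f l =
      (1 - m₂) * bdf x.2 * ∑ i, x.2 i * f (Sum.inr i) := by
  have hd : ∀ i : Fin (m₁ + 1) ⊕ Fin (m₂ + 1),
      Sum.elim (fun _ => (bdf x.1 ^ 2)⁻¹) (fun _ => (bdf x.2 ^ 2)⁻¹) i ≠ 0 := by
    rintro (i | i)
    exacts [inv_ne_zero (pow_ne_zero 2 h₁), inv_ne_zero (pow_ne_zero 2 h₂)]
  have key : ∀ i, bdf x.2 ^ 2 * ∑ l, christoffel ((stdBasis m₁).prod (stdBasis m₂))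
      (prodPoincare m₁ m₂) l (Sum.inr i) (Sum.inr i) x * f l =
      bdf x.2 * (2 * (x.2 i * f (Sum.inr i)) - ∑ l, x.2 l * f (Sum.inr l)) := by
    intro i
    simp only [christoffel_of_diagonal _ (gram_prodPoincare m₁ m₂) hd, Fintype.sum_sum_type,
      Sum.elim_inl, Sum.elim_inr, pd_prod_inr_snd h₂, pd_prod_inl_snd h₂, Sum.inr.injEq,
      reduceCtorEq, if_false, if_true, add_zero, sub_zero, mul_zero, zero_mul, zero_add,
      Finset.sum_const_zero]
    have : ∀ l, 1 / 2 * (bdf x.2 ^ 2)⁻¹⁻¹ * ((if i = l then 2 * (bdf x.2 ^ 3)⁻¹ * x.2 i else 0)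
        + (if i = l then 2 * (bdf x.2 ^ 3)⁻¹ * x.2 i else 0) - 2 * (bdf x.2 ^ 3)⁻¹ * x.2 l)
          * f (Sum.inr l)
        = (bdf x.2)⁻¹ * ((if i = l then 2 * (x.2 l * f (Sum.inr l)) else 0)
          - x.2 l * f (Sum.inr l)) := by
      intro l
      split_ifs with h
      · subst h; field_simp; ring
      · field_simp; ring
    simp only [this, ← Finset.mul_sum, Finset.sum_sub_distrib, Finset.sum_ite_eq,
      Finset.mem_univ, if_true]
    field_simp
  simp only [key, ← Finset.mul_sum, Finset.sum_sub_distrib, Finset.sum_const, Finset.card_univ,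
    Fintype.card_fin, nsmul_eq_mul]
  push_cast
  ring

theorem pd_coord {ι V : Type*} [NormedAddCommGroup V] [NormedSpace ℝ V]
    (b : Module.Basis ι ℝ V) {n : ℕ} {u : V → Euc n} {x : V} (hu : DifferentiableAt ℝ u x) (i : ι)
    (k : Fin (n + 1)) :
    pd b i (fun y => u y k) x = fderiv ℝ u x (b i) k := by
  have h := (EuclideanSpace.proj (𝕜 := ℝ) k : Euc n →L[ℝ] ℝ).hasFDerivAt.comp x hu.hasFDerivAt
  rw [pd]
  erw [h.fderiv]
  simp

theorem pd_pd_coord {ι V : Type*} [NormedAddCommGroup V] [NormedSpace ℝ V]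
    (b : Module.Basis ι ℝ V) {n : ℕ} {u : V → Euc n} {x : V} (hu : ContDiffAt ℝ 2 u x) (i j : ι)
    (k : Fin (n + 1)) :
    pd b i (pd b j fun y => u y k) x = fderiv ℝ (fderiv ℝ u) x (b i) (b j) k := by
  have h1 : pd b j (fun y => u y k) =ᶠ[nhds x] fun y => fderiv ℝ u y (b j) k := by
    filter_upwards [hu.eventually (by simp)] with y hy
    exact pd_coord b (hy.differentiableAt (by simp)) j k
  have h2 : DifferentiableAt ℝ (fderiv ℝ u) x :=
    (hu.fderiv_right (m := 1) (by norm_num)).differentiableAt (by simp)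
  have h3 : HasFDerivAt (fun y => fderiv ℝ u y (b j))
      ((ContinuousLinearMap.apply ℝ (Euc n) (b j)).comp (fderiv ℝ (fderiv ℝ u) x)) x :=
    (ContinuousLinearMap.apply ℝ (Euc n) (b j)).hasFDerivAt.comp x h2.hasFDerivAt
  have h4 := pd_coord b h3.differentiableAt i k
  rw [pd, h1.fderiv_eq]
  rw [pd] at h4
  rw [h4, h3.fderiv]
  rfl

/-- The radial component suffices for the corner analysis; the factor `bdf (u x)` clears the pole of
the target Christoffel symbols, so every factor on the right has a limit at the corner. -/
theorem inner_tension {m₁ m₂ n : ℕ} {u : Euc m₁ × Euc m₂ → Euc n} {x : Euc m₁ × Euc m₂}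
    (h₁ : bdf x.1 ≠ 0) (h₂ : bdf x.2 ≠ 0) (hr : bdf (u x) ≠ 0) (hu : ContDiffAt ℝ 2 u x) :
    bdf (u x) * inner ℝ (u x) (hypTension u x) =
      bdf (u x) * (bdf x.1 ^ 2 * ∑ i, inner ℝ (u x) (fderiv ℝ (fderiv ℝ u) x
          (EuclideanSpace.single i 1, 0) (EuclideanSpace.single i 1, 0))
        + bdf x.2 ^ 2 * ∑ i, inner ℝ (u x) (fderiv ℝ (fderiv ℝ u) x
          (0, EuclideanSpace.single i 1) (0, EuclideanSpace.single i 1)))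
      + bdf (u x) * ((m₁ - 1) * bdf x.1 * inner ℝ (u x) (fderiv ℝ u x (x.1, 0))
        + (m₂ - 1) * bdf x.2 * inner ℝ (u x) (fderiv ℝ u x (0, x.2)))
      + bdf x.1 ^ 2 * ∑ i, (2 * inner ℝ (u x) (fderiv ℝ u x (EuclideanSpace.single i 1, 0)) ^ 2
          - ‖u x‖ ^ 2 * ‖fderiv ℝ u x (EuclideanSpace.single i 1, 0)‖ ^ 2)
      + bdf x.2 ^ 2 * ∑ i, (2 * inner ℝ (u x) (fderiv ℝ u x (0, EuclideanSpace.single i 1)) ^ 2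
          - ‖u x‖ ^ 2 * ‖fderiv ℝ u x (0, EuclideanSpace.single i 1)‖ ^ 2) := by
  have hd : ∀ i : Fin (m₁ + 1) ⊕ Fin (m₂ + 1),
      Sum.elim (fun _ => (bdf x.1 ^ 2)⁻¹) (fun _ => (bdf x.2 ^ 2)⁻¹) i ≠ 0 := by
    rintro (i | i)
    exacts [inv_ne_zero (pow_ne_zero 2 h₁), inv_ne_zero (pow_ne_zero 2 h₂)]
  have hu1 : DifferentiableAt ℝ u x := hu.differentiableAt (by simp)
  set b := (stdBasis m₁).prod (stdBasis m₂) with hb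
  have hx1 : ∑ i, x.1 i • fderiv ℝ u x (b (Sum.inl i)) = fderiv ℝ u x (x.1, 0) := by
    rw [← (fderiv ℝ u x).coe_coe]
    simp only [← map_smul, ← map_sum]
    congr 1
    ext j
    · simp [hb, Prod.fst_sum, Finset.sum_apply, Pi.single_apply]
    · simp [hb, Prod.snd_sum]
  have hx2 : ∑ i, x.2 i • fderiv ℝ u x (b (Sum.inr i)) = fderiv ℝ u x (0, x.2) := by
    rw [← (fderiv ℝ u x).coe_coe]
    simp only [← map_smul, ← map_sum]
    congr 1
    ext j
    · simp [hb, Prod.fst_sum]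
    · simp [hb, Prod.snd_sum, Finset.sum_apply, Pi.single_apply]
  have hcoord : ∀ k, hypTension u x k =
      bdf x.1 ^ 2 * ∑ i, fderiv ℝ (fderiv ℝ u) x (b (Sum.inl i)) (b (Sum.inl i)) k
      + bdf x.2 ^ 2 * ∑ i, fderiv ℝ (fderiv ℝ u) x (b (Sum.inr i)) (b (Sum.inr i)) k
      + (m₁ - 1) * bdf x.1 * fderiv ℝ u x (x.1, 0) k
      + (m₂ - 1) * bdf x.2 * fderiv ℝ u x (0, x.2) k
      + bdf x.1 ^ 2 * ∑ i, (bdf (u x))⁻¹ *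
        (2 * inner ℝ (u x) (fderiv ℝ u x (b (Sum.inl i))) * fderiv ℝ u x (b (Sum.inl i)) k
          - ‖fderiv ℝ u x (b (Sum.inl i))‖ ^ 2 * u x k)
      + bdf x.2 ^ 2 * ∑ i, (bdf (u x))⁻¹ *
        (2 * inner ℝ (u x) (fderiv ℝ u x (b (Sum.inr i))) * fderiv ℝ u x (b (Sum.inr i)) k
          - ‖fderiv ℝ u x (b (Sum.inr i))‖ ^ 2 * u x k) := by
    intro k
    have e : hypTension u x k = tensionCoord b (prodPoincare m₁ m₂) (stdBasis n) (poincare n) u x k := by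
      simp [hypTension, tension, hb, Finset.sum_apply, Pi.single_apply]
    have c1 := sum_inl_christoffel_prodPoincare h₁ h₂ fun l => fderiv ℝ u x (b l) k
    have c2 := sum_inr_christoffel_prodPoincare h₁ h₂ fun l => fderiv ℝ u x (b l) k
    have d1 : ∑ i, x.1 i * fderiv ℝ u x (b (Sum.inl i)) k = fderiv ℝ u x (x.1, 0) k := by
      rw [← hx1]; simp [Finset.sum_apply]
    have d2 : ∑ i, x.2 i * fderiv ℝ u x (b (Sum.inr i)) k = fderiv ℝ u x (0, x.2) k := by
      rw [← hx2]; simp [Finset.sum_apply]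
    rw [d1] at c1
    rw [d2] at c2
    rw [e, tensionCoord_of_diagonal b (gram_prodPoincare m₁ m₂) hd]
    simp only [stdBasis_repr, pd_coord b hu1, pd_pd_coord b hu, sum_christoffel_poincare hr,
      Fintype.sum_sum_type, Sum.elim_inl, Sum.elim_inr, inv_inv, mul_add, mul_sub,
      Finset.sum_add_distrib, Finset.sum_sub_distrib]
    simp only [Fintype.sum_sum_type] at c1 c2
    simp only [mul_add, Finset.sum_add_distrib] at c1 c2
    simp only [Finset.mul_sum] at c1 c2 ⊢
    -- The two traced source Christoffel identities are the only non-formal input; they enter the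
    -- tension with a minus sign.
    linear_combination -c1 - c2
  have hb1 : ∀ i, b (Sum.inl i) = (EuclideanSpace.single i 1, 0) := by
    intro i; simp [hb]
  have hb2 : ∀ i, b (Sum.inr i) = (0, EuclideanSpace.single i 1) := by
    intro i; simp [hb]
  have hvec : hypTension u x =
      bdf x.1 ^ 2 • ∑ i, fderiv ℝ (fderiv ℝ u) x (b (Sum.inl i)) (b (Sum.inl i))
      + bdf x.2 ^ 2 • ∑ i, fderiv ℝ (fderiv ℝ u) x (b (Sum.inr i)) (b (Sum.inr i))
      + ((m₁ - 1) * bdf x.1) • fderiv ℝ u x (x.1, 0)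
      + ((m₂ - 1) * bdf x.2) • fderiv ℝ u x (0, x.2)
      + bdf x.1 ^ 2 • ∑ i, (bdf (u x))⁻¹ •
        ((2 * inner ℝ (u x) (fderiv ℝ u x (b (Sum.inl i)))) • fderiv ℝ u x (b (Sum.inl i))
          - ‖fderiv ℝ u x (b (Sum.inl i))‖ ^ 2 • u x)
      + bdf x.2 ^ 2 • ∑ i, (bdf (u x))⁻¹ •
        ((2 * inner ℝ (u x) (fderiv ℝ u x (b (Sum.inr i)))) • fderiv ℝ u x (b (Sum.inr i))
          - ‖fderiv ℝ u x (b (Sum.inr i))‖ ^ 2 • u x) := by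
    ext k
    rw [hcoord k]
    simp [Finset.sum_apply]
  rw [hvec]
  simp only [inner_add_right, inner_smul_right, inner_sum, inner_sub_right,
    real_inner_self_eq_norm_sq, ← Finset.mul_sum, hb1, hb2]
  field_simp
  simp only [Finset.sum_sub_distrib, ← Finset.mul_sum, ← Finset.sum_mul]
  ring

/-! ### First derivatives at the boundary sphere -/

/-- Differentiate |F|² = 1 along the great circle through q with velocity v; the circle lies in the
closed ball, so the one-sided derivative `L` suffices. -/
theorem inner_fderivWithin_eq_zero_of_orthogonal {m n : ℕ} {F : Euc m → Euc n}
    {L : Euc m →L[ℝ] Euc n} {q : Euc m} (hq : ‖q‖ = 1)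
    (hF : HasFDerivWithinAt F L (Metric.closedBall 0 1) q)
    (hs : Set.MapsTo F (Metric.sphere 0 1) (Metric.sphere 0 1)) {v : Euc m}
    (hv : inner ℝ q v = 0) : inner ℝ (F q) (L v) = 0 := by
  -- Unit length puts cos θ q + sin θ v on the sphere.
  wlog hv1 : ‖v‖ = 1 generalizing v
  · rcases eq_or_ne v 0 with rfl | h0
    · simp
    · have h1 : ‖v‖ ≠ 0 := norm_ne_zero_iff.mpr h0
      have h := this (v := ‖v‖⁻¹ • v) (by rw [inner_smul_right, hv, mul_zero])
        (by rw [norm_smul, norm_inv, norm_norm, inv_mul_cancel₀ h1])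
      rw [map_smul, inner_smul_right] at h
      exact (mul_eq_zero.mp h).resolve_left (inv_ne_zero h1)
  let γ : ℝ → Euc m := fun θ => Real.cos θ • q + Real.sin θ • v
  have hγ : ∀ θ, ‖γ θ‖ = 1 := by
    intro θ
    have h : ‖γ θ‖ ^ 2 = 1 := by
      rw [norm_add_sq_real, norm_smul, norm_smul, inner_smul_left, inner_smul_right, hv, hq, hv1]
      simp
    nlinarith [norm_nonneg (γ θ)]
  have hγ0 : γ 0 = q := by simp [γ]
  have hγ' : HasDerivAt γ v 0 := by
    have := ((Real.hasDerivAt_cos 0).smul_const q).add ((Real.hasDerivAt_sin 0).smul_const v)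
    simp only [Real.sin_zero, Real.cos_zero, neg_zero, zero_smul, one_smul, zero_add] at this
    exact this
  have hFγ : HasDerivAt (F ∘ γ) (L v) 0 := by
    rw [← hγ0] at hF
    have := hF.comp_hasDerivWithinAt (0 : ℝ) hγ'.hasDerivWithinAt (s := Set.univ)
      (fun θ _ => by simp [hγ θ])
    simpa using this
  have h1 := hFγ.norm_sq
  have h2 : (fun θ => ‖(F ∘ γ) θ‖ ^ 2) = fun _ => (1 : ℝ) := by
    ext θ
    have : F (γ θ) ∈ Metric.sphere (0 : Euc n) 1 := hs (by simp [hγ θ])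
    simp at this
    simp [this]
  rw [h2] at h1
  have h3 := h1.unique (hasDerivAt_const 0 1)
  simp only [Function.comp, hγ0] at h3
  linarith

/-- By orthogonality the functional v ↦ ⟨F q, L v⟩ is a multiple of ⟨q, ·⟩, and q is a unit vector.
-/
theorem sum_sq_inner_fderivWithin {m n : ℕ} {F : Euc m → Euc n}
    {L : Euc m →L[ℝ] Euc n} {q : Euc m} (hq : ‖q‖ = 1)
    (hF : HasFDerivWithinAt F L (Metric.closedBall 0 1) q)
    (hs : Set.MapsTo F (Metric.sphere 0 1) (Metric.sphere 0 1)) :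
    ∑ i, inner ℝ (F q) (L (EuclideanSpace.single i 1)) ^ 2 = inner ℝ (F q) (L q) ^ 2 := by
  have key : ∀ v, inner ℝ (F q) (L v) = inner ℝ q v * inner ℝ (F q) (L q) := by
    intro v
    have h := inner_fderivWithin_eq_zero_of_orthogonal hq hF hs (v := v - inner ℝ q v • q)
      (by rw [inner_sub_right, inner_smul_right, real_inner_self_eq_norm_sq, hq]; ring)
    rw [map_sub, map_smul, inner_sub_right, inner_smul_right] at h
    linarith
  have h1 : ∑ i, q i ^ 2 = 1 := by rw [← EuclideanSpace.real_norm_sq_eq, hq]; norm_num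
  simp only [key (EuclideanSpace.single _ _), mul_pow, ← Finset.sum_mul,
    EuclideanSpace.inner_single_right]
  simp [h1]

/-- If all these terms vanished, `L` would be zero; by the chain rule so would the differential of ψ
followed by the inclusion of the sphere, which is an immersion. -/
theorem sum_norm_sq_fderivWithin_pos {m n : ℕ} {F : Euc m → Euc n}
    {L : Euc m →L[ℝ] Euc n} {q : Sph m}
    (hF : HasFDerivWithinAt F L (Metric.closedBall 0 1) q)
    {ψ : Sph m → Sph n} (hψ : ∀ x : Sph m, F x = ψ x)
    (hd : mfderiv (𝓡 m) (𝓡 n) ψ q ≠ 0) :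
    0 < ∑ i, ‖L (EuclideanSpace.single i 1)‖ ^ 2 := by
  have hL : L ≠ 0 := by
    rintro rfl
    apply hd
    have := Fact.mk (@finrank_euclideanSpace_fin ℝ _ (m + 1))
    have := Fact.mk (@finrank_euclideanSpace_fin ℝ _ (n + 1))
    -- `mfderiv` is zero by convention at points of non-differentiability, so its nonvanishing
    -- forces differentiability.
    have hψd : MDifferentiableAt (𝓡 m) (𝓡 n) ψ q := by
      by_contra h
      exact hd (mfderiv_zero_of_not_mdifferentiableAt h)
    have hcm : MDifferentiableAt (𝓡 m) 𝓘(ℝ, Euc m) ((↑) : Sph m → Euc m) q :=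
      (contMDiff_coe_sphere (n := m) (m := 1) q).mdifferentiableAt one_ne_zero
    have hcn : MDifferentiableAt (𝓡 n) 𝓘(ℝ, Euc n) ((↑) : Sph n → Euc n) (ψ q) :=
      (contMDiff_coe_sphere (n := n) (m := 1) (ψ q)).mdifferentiableAt one_ne_zero
    have h1 := HasMFDerivWithinAt.comp (q : Sph m) hF.hasMFDerivWithinAt
      (hcm.hasMFDerivAt.hasMFDerivWithinAt (s := Set.univ)) fun x _ => by simp
    rw [hasMFDerivWithinAt_univ] at h1
    have h2 := hcn.hasMFDerivAt.comp q hψd.hasMFDerivAt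
    have h3 : F ∘ ((↑) : Sph m → Euc m) = ((↑) : Sph n → Euc n) ∘ ψ := funext hψ
    rw [h3] at h1
    have h4 := hasMFDerivAt_unique h2 h1
    ext1 v
    apply injective_mvfderiv_subtypeVal_sphere (n := n) (ψ q)
    exact (DFunLike.congr_fun h4 v).trans (map_zero (mvfderiv (𝓡 n) ((↑) : Sph n → Euc n) (ψ q))).symm
  by_contra h
  have h0 : ∀ i, L (EuclideanSpace.single i 1) = 0 := by
    intro i
    have h1 := (Finset.sum_eq_zero_iff_of_nonneg (fun i _ => sq_nonneg _)).mp
      (le_antisymm (not_lt.mp h)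
        (Finset.sum_nonneg fun i _ => sq_nonneg ‖L (EuclideanSpace.single i 1)‖))
      i (Finset.mem_univ i)
    simpa using h1
  apply hL
  have : (L : Euc m →ₗ[ℝ] Euc n) = 0 :=
    (stdBasis m).ext fun i => by simpa using h0 i
  ext1 v
  exact DFunLike.congr_fun this v

/-! ### Asymptotics of the tension field at the corner -/

theorem uniqueDiffOn_closedSpace (m₁ m₂ : ℕ) : UniqueDiffOn ℝ (closedSpace m₁ m₂) := by
  have h : ∀ m, UniqueDiffOn ℝ (Metric.closedBall (0 : Euc m) 1) := fun m =>
    uniqueDiffOn_convex (convex_closedBall 0 1)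
      ⟨0, Metric.ball_subset_interior_closedBall (by simp)⟩
  exact (h m₁).prod (h m₂)

theorem isOpen_space (m₁ m₂ : ℕ) : IsOpen (space m₁ m₂) := Metric.isOpen_ball.prod Metric.isOpen_ball

theorem space_subset_closedSpace (m₁ m₂ : ℕ) : space m₁ m₂ ⊆ closedSpace m₁ m₂ :=
  Set.prod_mono Metric.ball_subset_closedBall Metric.ball_subset_closedBall

theorem closedSpace_mem_nhds {m₁ m₂ : ℕ} {p : Euc m₁ × Euc m₂} (hp : p ∈ space m₁ m₂) :
    closedSpace m₁ m₂ ∈ nhds p :=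
  Filter.mem_of_superset ((isOpen_space m₁ m₂).mem_nhds hp) (space_subset_closedSpace m₁ m₂)

theorem fderiv_fderiv_eq_fderivWithin {m₁ m₂ n : ℕ} (u : Euc m₁ × Euc m₂ → Euc n)
    {p : Euc m₁ × Euc m₂} (hp : p ∈ space m₁ m₂) :
    fderivWithin ℝ (fderivWithin ℝ u (closedSpace m₁ m₂)) (closedSpace m₁ m₂) p
      = fderiv ℝ (fderiv ℝ u) p := by
  rw [fderivWithin_of_mem_nhds (closedSpace_mem_nhds hp)]
  apply Filter.EventuallyEq.fderiv_eq
  filter_upwards [(isOpen_space m₁ m₂).mem_nhds hp] with x hx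
  exact fderivWithin_of_mem_nhds (closedSpace_mem_nhds hx)

theorem hypTensionNorm_eq {m₁ m₂ n : ℕ} (u : Euc m₁ × Euc m₂ → Euc n) {x : Euc m₁ × Euc m₂}
    (hr : 0 < bdf (u x)) : hypTensionNorm u x = (bdf (u x))⁻¹ * ‖hypTension u x‖ := by
  rw [hypTensionNorm, poincare_eq, real_inner_self_eq_norm_sq, ← inv_pow, ← mul_pow,
    Real.sqrt_sq (by positivity)]

theorem bdf_smul_sphere {m : ℕ} {q : Euc m} (hq : ‖q‖ = 1) (t : ℝ) :
    bdf ((1 - t) • q) = t - t ^ 2 / 2 := by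
  rw [bdf, norm_smul, hq, mul_one, Real.norm_eq_abs, sq_abs]
  ring

-- This is the limit of `inner_tension` divided by ε² along a path into the corner whose speeds α, β
-- in the two factors are independent; varying them later separates the coefficients.
open Filter Topology in
theorem corner_quadratic_relation {m₁ m₂ n : ℕ} {u : Euc m₁ × Euc m₂ → Euc n}
    {φ : Sph m₁ × Sph m₂ → Sph n} (hu : LiTamHypotheses u φ)
    (hC2 : ContDiffOn ℝ 2 u (closedSpace m₁ m₂)) {q : Euc m₁ × Euc m₂} (hq : q ∈ corner m₁ m₂)
    {L : Euc m₁ × Euc m₂ →L[ℝ] Euc n} (hL : L = fderivWithin ℝ u (closedSpace m₁ m₂) q)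
    {α β : ℝ} (hα : 0 < α) (hβ : 0 < β) :
    (α * inner ℝ (u q) (L (q.1, 0)) + β * inner ℝ (u q) (L (0, q.2))) *
      ((m₁ - 1) * α * inner ℝ (u q) (L (q.1, 0)) + (m₂ - 1) * β * inner ℝ (u q) (L (0, q.2)))
      + α ^ 2 * ∑ i, (2 * inner ℝ (u q) (L (EuclideanSpace.single i 1, 0)) ^ 2
          - ‖L (EuclideanSpace.single i 1, 0)‖ ^ 2)
      + β ^ 2 * ∑ i, (2 * inner ℝ (u q) (L (0, EuclideanSpace.single i 1)) ^ 2
          - ‖L (0, EuclideanSpace.single i 1)‖ ^ 2) = 0 := by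
  set S := closedSpace m₁ m₂ with hS
  have hq1 : ‖q.1‖ = 1 := by simpa using hq.1
  have hq2 : ‖q.2‖ = 1 := by simpa using hq.2
  have hqS : q ∈ S := ⟨by simp [hq1], by simp [hq2]⟩
  have huq : ‖u q‖ = 1 := by simpa using hu.mapsTo_corner hq
  let p : ℝ → Euc m₁ × Euc m₂ := fun ε => ((1 - α * ε) • q.1, (1 - β * ε) • q.2)
  have hp0 : p 0 = q := by simp [p]
  -- For these ε both scaling factors 1 - αε and 1 - βε lie strictly between 0 and 1.
  set T : Set ℝ := Set.Ioo 0 (min α⁻¹ β⁻¹) with hT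
  have hTpos : (0 : ℝ) < min α⁻¹ β⁻¹ := lt_min (inv_pos.mpr hα) (inv_pos.mpr hβ)
  have : (𝓝[T] (0 : ℝ)).NeBot := left_nhdsWithin_Ioo_neBot hTpos
  have hself : ∀ᶠ ε in 𝓝[T] (0 : ℝ), ε ∈ T := self_mem_nhdsWithin
  have hpX : ∀ ε ∈ T, p ε ∈ space m₁ m₂ := by
    rintro ε ⟨h0, h1⟩
    have hball : ∀ {c : ℝ}, 0 < c → ε < c⁻¹ → |1 - c * ε| < 1 := by
      intro c hc h
      have h2 : c * ε < 1 := by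
        calc c * ε < c * c⁻¹ := mul_lt_mul_of_pos_left h hc
          _ = 1 := mul_inv_cancel₀ hc.ne'
      have h3 : 0 < c * ε := mul_pos hc h0
      rw [abs_lt]; constructor <;> linarith
    refine ⟨?_, ?_⟩
    · simpa [p, norm_smul, hq1] using hball hα (lt_of_lt_of_le h1 (min_le_left _ _))
    · simpa [p, norm_smul, hq2] using hball hβ (lt_of_lt_of_le h1 (min_le_right _ _))
  have hp' : HasDerivAt p (-(α • q.1), -(β • q.2)) 0 := by
    have h : ∀ c : ℝ, HasDerivAt (fun ε : ℝ => 1 - c * ε) (-c) 0 := by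
      intro c
      simpa using ((hasDerivAt_id (0 : ℝ)).const_mul c).const_sub 1
    have := ((h α).smul_const q.1).prodMk ((h β).smul_const q.2)
    simpa using this
  have hpt : Tendsto p (𝓝[T] 0) (𝓝[S] q) := by
    refine tendsto_nhdsWithin_iff.mpr ⟨?_, ?_⟩
    · have := hp'.continuousAt.tendsto
      rw [hp0] at this
      exact this.mono_left nhdsWithin_le_nhds
    · filter_upwards [hself] with ε hε
      exact space_subset_closedSpace _ _ (hpX ε hε)
  have hD : ContDiffOn ℝ 1 (fderivWithin ℝ u S) S :=
    hC2.fderivWithin (uniqueDiffOn_closedSpace m₁ m₂) (by norm_num)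
  have hut : Tendsto (fun ε => u (p ε)) (𝓝[T] 0) (𝓝 (u q)) :=
    (hC2.continuousOn q hqS).tendsto.comp hpt
  have hDt : Tendsto (fun ε => fderiv ℝ u (p ε)) (𝓝[T] 0) (𝓝 L) := by
    rw [hL]
    refine ((hD.continuousOn q hqS).tendsto.comp hpt).congr' ?_
    filter_upwards [hself] with ε hε
    exact fderivWithin_of_mem_nhds (closedSpace_mem_nhds (hpX ε hε))
  -- Here C² regularity at the corner itself is essential: the second derivatives must stay bounded.
  -- The value of the limit plays no role.
  obtain ⟨M, hMt⟩ : ∃ M, Tendsto (fun ε => fderiv ℝ (fderiv ℝ u) (p ε)) (𝓝[T] 0) (𝓝 M) := by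
    refine ⟨_, (((hD.continuousOn_fderivWithin (uniqueDiffOn_closedSpace m₁ m₂)
      le_rfl) q hqS).tendsto.comp hpt).congr' ?_⟩
    filter_upwards [hself] with ε hε
    exact fderiv_fderiv_eq_fderivWithin u (hpX ε hε)
  have hρ : ∀ {m : ℕ} {v : Euc m} (_ : ‖v‖ = 1) (c : ℝ),
      Tendsto (fun ε => bdf ((1 - c * ε) • v) / ε) (𝓝[T] 0) (𝓝 c) := by
    intro m v hv c
    have h : Tendsto (fun ε : ℝ => c - c ^ 2 * ε / 2) (𝓝[T] 0) (𝓝 (c - c ^ 2 * 0 / 2)) :=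
      Tendsto.mono_left (Continuous.tendsto (by fun_prop) 0) nhdsWithin_le_nhds
    rw [show c - c ^ 2 * 0 / 2 = c by ring] at h
    refine h.congr' ?_
    filter_upwards [hself] with ε hε
    have : ε ≠ 0 := hε.1.ne'
    rw [bdf_smul_sphere hv]
    field_simp
  have hρ1 := hρ hq1 α
  have hρ2 := hρ hq2 β
  have hr : Tendsto (fun ε => bdf (u (p ε)) / ε) (𝓝[T] 0)
      (𝓝 (α * inner ℝ (u q) (L (q.1, 0)) + β * inner ℝ (u q) (L (0, q.2)))) := by
    have h1 : HasFDerivWithinAt u L S (p 0) := by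
      rw [hp0, hL]
      exact (hC2.differentiableOn (by simp) q hqS).hasFDerivWithinAt
    have h2 : HasDerivWithinAt (u ∘ p) (L (-(α • q.1), -(β • q.2))) T 0 :=
      h1.comp_hasDerivWithinAt 0 hp'.hasDerivWithinAt
        fun ε hε => space_subset_closedSpace _ _ (hpX ε hε)
    have h3 := (hasFDerivAt_bdf ((u ∘ p) 0)).comp_hasDerivWithinAt 0 h2
    rw [hasDerivWithinAt_iff_tendsto_slope' (by simp [hT])] at h3
    have h4 : (-innerSL ℝ ((u ∘ p) 0)) (L (-(α • q.1), -(β • q.2))) =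
        α * inner ℝ (u q) (L (q.1, 0)) + β * inner ℝ (u q) (L (0, q.2)) := by
      have : ((-(α • q.1), -(β • q.2)) : Euc m₁ × Euc m₂)
          = -(α • (q.1, 0) + β • (0, q.2)) := by simp
      rw [this, map_neg, map_add, map_smul, map_smul]
      simp [hp0, inner_add_right, inner_smul_right]
    rw [h4] at h3
    refine h3.congr fun ε => ?_
    have h5 : bdf (u q) = 0 := by simp [bdf, huq]
    simp [slope, hp0, h5, div_eq_inv_mul]
  have hN : Tendsto (fun ε => hypTensionNorm u (p ε)) (𝓝[T] 0) (𝓝 0) := by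
    rw [Metric.tendsto_nhds]
    intro η hη
    obtain ⟨δ, hδ, h⟩ := hu.tension_tendsto_zero η hη
    have h1 := (tendsto_nhdsWithin_iff.mp hpt).1
    filter_upwards [hself, Metric.tendsto_nhds.mp h1 δ hδ] with ε hε hd
    have := h (p ε) (hpX ε hε) q (Or.inl ⟨hq.1, hqS.2⟩) hd
    rw [Real.dist_eq, sub_zero, abs_of_nonneg (show 0 ≤ hypTensionNorm u (p ε) from Real.sqrt_nonneg _)]
    exact this
  have hpos : ∀ ε ∈ T, 0 < bdf (u (p ε)) := by
    intro ε hε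
    apply bdf_pos
    apply hu.mapsTo_off_corner
    refine ⟨space_subset_closedSpace _ _ (hpX ε hε), fun hc => ?_⟩
    have h1 := (hpX ε hε).1
    have h2 := hc.1
    simp only [mem_ball_zero_iff, mem_sphere_zero_iff_norm] at h1 h2
    exact h1.ne h2
  -- The quotient is at most (r/ε)² |τ(u)| in absolute value, with r = `bdf (u (p ε))`: the
  -- hyperbolic norm already carries one factor 1/r.
  have hlhs : Tendsto (fun ε => bdf (u (p ε)) * inner ℝ (u (p ε)) (hypTension u (p ε)) / ε ^ 2)
      (𝓝[T] 0) (𝓝 0) := by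
    have h1 := (hr.pow 2).mul hN
    rw [mul_zero] at h1
    refine squeeze_zero_norm' ?_ h1
    filter_upwards [hself] with ε hε
    have hb := hpos ε hε
    have hu1 : ‖u (p ε)‖ ≤ 1 := by
      unfold bdf at hb
      nlinarith [norm_nonneg (u (p ε))]
    have h2 : |inner ℝ (u (p ε)) (hypTension u (p ε))| ≤ ‖hypTension u (p ε)‖ :=
      (abs_real_inner_le_norm _ _).trans (mul_le_of_le_one_left (norm_nonneg _) hu1)
    rw [hypTensionNorm_eq u hb, Real.norm_eq_abs, abs_div, abs_mul, abs_of_pos hb, abs_sq]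
    calc _ ≤ bdf (u (p ε)) * ‖hypTension u (p ε)‖ / ε ^ 2 := by gcongr
      _ = _ := by field_simp
  have hDv : ∀ v, Tendsto (fun ε => fderiv ℝ u (p ε) v) (𝓝[T] 0) (𝓝 (L v)) := fun v =>
    ((ContinuousLinearMap.apply ℝ (Euc n) v).continuous.tendsto L).comp hDt
  have hMv : ∀ v w, Tendsto (fun ε => fderiv ℝ (fderiv ℝ u) (p ε) v w) (𝓝[T] 0)
      (𝓝 (M v w)) := fun v w =>
    ((ContinuousLinearMap.apply ℝ (Euc n) w).continuous.tendsto (M v)).comp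
      (((ContinuousLinearMap.apply ℝ _ v).continuous.tendsto M).comp hMt)
  have hid : Tendsto (fun ε : ℝ => ε) (𝓝[T] 0) (𝓝 0) := tendsto_id.mono_left nhdsWithin_le_nhds
  have hpt' := (tendsto_nhdsWithin_iff.mp hpt).1
  have hx1 : Tendsto (fun ε => fderiv ℝ u (p ε) ((p ε).1, 0)) (𝓝[T] 0) (𝓝 (L (q.1, 0))) :=
    (isBoundedBilinearMap_apply.continuous.tendsto (L, (q.1, 0))).comp
      (hDt.prodMk_nhds (((continuous_fst.prodMk continuous_const).tendsto q).comp hpt'))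
  have hx2 : Tendsto (fun ε => fderiv ℝ u (p ε) (0, (p ε).2)) (𝓝[T] 0) (𝓝 (L (0, q.2))) :=
    (isBoundedBilinearMap_apply.continuous.tendsto (L, (0, q.2))).comp
      (hDt.prodMk_nhds (((continuous_const.prodMk continuous_snd).tendsto q).comp hpt'))
  have hterm : ∀ v, Tendsto (fun ε => 2 * inner ℝ (u (p ε)) (fderiv ℝ u (p ε) v) ^ 2
      - ‖u (p ε)‖ ^ 2 * ‖fderiv ℝ u (p ε) v‖ ^ 2) (𝓝[T] 0)
      (𝓝 (2 * inner ℝ (u q) (L v) ^ 2 - ‖L v‖ ^ 2)) := by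
    intro v
    have := (((hut.inner (𝕜 := ℝ) (hDv v)).pow 2).const_mul 2).sub
      ((hut.norm.pow 2).mul ((hDv v).norm.pow 2))
    simpa [huq] using this
  have hS1 := tendsto_finsetSum Finset.univ
    fun (i : Fin (m₁ + 1)) _ => hterm (EuclideanSpace.single i 1, 0)
  have hS2 := tendsto_finsetSum Finset.univ
    fun (i : Fin (m₂ + 1)) _ => hterm (0, EuclideanSpace.single i 1)
  have hM1 := tendsto_finsetSum Finset.univ fun (i : Fin (m₁ + 1)) _ =>
    hut.inner (𝕜 := ℝ) (hMv (EuclideanSpace.single i 1, 0) (EuclideanSpace.single i 1, 0))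
  have hM2 := tendsto_finsetSum Finset.univ fun (i : Fin (m₂ + 1)) _ =>
    hut.inner (𝕜 := ℝ) (hMv (0, EuclideanSpace.single i 1) (0, EuclideanSpace.single i 1))
  -- In the first summand r/ε is multiplied by a surplus ε, which kills the second derivatives in
  -- the limit.
  have hrhs := ((((hr.mul hid).mul (((hρ1.pow 2).mul hM1).add ((hρ2.pow 2).mul hM2))).add
    (hr.mul (((hρ1.const_mul ((m₁ : ℝ) - 1)).mul (hut.inner (𝕜 := ℝ) hx1)).add
      ((hρ2.const_mul ((m₂ : ℝ) - 1)).mul (hut.inner (𝕜 := ℝ) hx2))))).add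
    ((hρ1.pow 2).mul hS1)).add ((hρ2.pow 2).mul hS2)
  rw [mul_zero, zero_mul, zero_add] at hrhs
  refine tendsto_nhds_unique hrhs (hlhs.congr' ?_)
  filter_upwards [hself] with ε hε
  have hX := hpX ε hε
  have hε0 : ε ≠ 0 := hε.1.ne'
  rw [inner_tension (bdf_pos hX.1).ne' (bdf_pos hX.2).ne' (hpos ε hε).ne'
    (hC2.contDiffAt (closedSpace_mem_nhds hX))]
  simp only [p]
  field_simp

end HypProd

/-! ### Comparison of coefficients -/

theorem mainTheorem4 (m₁ m₂ n : ℕ) (hm₁ : 0 < m₁) (hm₂ : 0 < m₂) (hn : 0 < n)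
    (u : HypProd.Euc m₁ × HypProd.Euc m₂ → HypProd.Euc n)
    (φ : HypProd.Sph m₁ × HypProd.Sph m₂ → HypProd.Sph n)
    (hu : HypProd.LiTamHypotheses u φ)
    (hC2 : ContDiffOn ℝ 2 u (HypProd.closedSpace m₁ m₂)) :
    m₁ = 1 ∧ m₂ = 1 := by
  open HypProd in
  have hne : ∀ m, ∃ q : Euc m, q ∈ Metric.sphere (0 : Euc m) 1 := fun m =>
    ⟨EuclideanSpace.single 0 1, by simp⟩
  obtain ⟨q₁, hq₁⟩ := hne m₁
  obtain ⟨q₂, hq₂⟩ := hne m₂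
  have hqS : (q₁, q₂) ∈ closedSpace m₁ m₂ :=
    ⟨Metric.sphere_subset_closedBall hq₁, Metric.sphere_subset_closedBall hq₂⟩
  obtain ⟨L, hL⟩ : ∃ L, L = fderivWithin ℝ u (closedSpace m₁ m₂) (q₁, q₂) := ⟨_, rfl⟩
  have hLd : HasFDerivWithinAt u L (closedSpace m₁ m₂) (q₁, q₂) := by
    rw [hL]
    exact (hC2.differentiableOn (by simp) _ hqS).hasFDerivWithinAt
  have hF1 : HasFDerivWithinAt (fun x => u (x, q₂)) (L.comp (ContinuousLinearMap.inl ℝ _ _))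
      (Metric.closedBall 0 1) q₁ :=
    HasFDerivWithinAt.comp (g := u) (t := closedSpace m₁ m₂) q₁ hLd
      (hasFDerivAt_prodMk_left q₁ q₂).hasFDerivWithinAt fun x hx => ⟨hx, hqS.2⟩
  have hF2 : HasFDerivWithinAt (fun y => u (q₁, y)) (L.comp (ContinuousLinearMap.inr ℝ _ _))
      (Metric.closedBall 0 1) q₂ :=
    HasFDerivWithinAt.comp (g := u) (t := closedSpace m₁ m₂) q₂ hLd
      (hasFDerivAt_prodMk_right q₁ q₂).hasFDerivWithinAt fun x hx => ⟨hqS.1, hx⟩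
  have hA := sum_sq_inner_fderivWithin (by simpa using hq₁) hF1
    fun x hx => hu.mapsTo_corner ⟨hx, hq₂⟩
  have hB := sum_sq_inner_fderivWithin (by simpa using hq₂) hF2
    fun x hx => hu.mapsTo_corner ⟨hq₁, hx⟩
  have hE1 := sum_norm_sq_fderivWithin_pos (q := ⟨q₁, hq₁⟩) hF1
    (ψ := fun x => φ (x, ⟨q₂, hq₂⟩)) (fun x => hu.corner_value x ⟨q₂, hq₂⟩) (hu.nondegenerate₁ ⟨q₁, hq₁⟩ ⟨q₂, hq₂⟩)
  have hE2 := sum_norm_sq_fderivWithin_pos (q := ⟨q₂, hq₂⟩) hF2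
    (ψ := fun x => φ (⟨q₁, hq₁⟩, x)) (fun x => hu.corner_value ⟨q₁, hq₁⟩ x) (hu.nondegenerate₂ ⟨q₁, hq₁⟩ ⟨q₂, hq₂⟩)
  simp only [ContinuousLinearMap.comp_apply, ContinuousLinearMap.inl_apply,
    ContinuousLinearMap.inr_apply] at hA hB hE1 hE2
  have hqc : (q₁, q₂) ∈ corner m₁ m₂ := ⟨hq₁, hq₂⟩
  have key := fun (α β : ℝ) => corner_quadratic_relation hu hC2 hqc hL (α := α) (β := β)
  simp only [Finset.sum_sub_distrib, ← Finset.mul_sum, hA, hB] at key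
  -- A binary quadratic form has three coefficients, and its values at (1,1), (2,1), (1,2) determine
  -- them.
  have k1 := key 1 1 one_pos one_pos
  have k2 := key 2 1 two_pos one_pos
  have k3 := key 1 2 one_pos two_pos
  generalize inner ℝ (u (q₁, q₂)) (L (q₁, 0)) = A at *
  generalize inner ℝ (u (q₁, q₂)) (L (0, q₂)) = B at *
  generalize ∑ i, ‖L (EuclideanSpace.single i 1, 0)‖ ^ 2 = E₁ at *
  generalize ∑ i, ‖L (0, EuclideanSpace.single i 1)‖ ^ 2 = E₂ at *
  have hAB : A * B * ((m₁ : ℝ) + m₂ - 2) = 0 := by nlinarith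
  have hA2 : (m₁ + 1) * A ^ 2 = E₁ := by nlinarith
  have hB2 : (m₂ + 1) * B ^ 2 = E₂ := by nlinarith
  -- A = 0 would force E₁ = 0, against the nondegeneracy of d₁φ.
  have hA0 : A ≠ 0 := by
    rintro rfl
    simp at hA2; linarith
  have hB0 : B ≠ 0 := by
    rintro rfl
    simp at hB2; linarith
  have h := (mul_eq_zero.mp hAB).resolve_left (mul_ne_zero hA0 hB0)
  have h' : m₁ + m₂ = 2 := by
    have : (m₁ : ℝ) + m₂ = 2 := by linarith
    exact_mod_cast this
  omega
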